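/- Call a (not necessarily commutative) multiplicative monoid $\mathcal M$ with group of units $\mathcal M^*$, equipped with a second operation $+$ and a map $|\cdot|:\mathcal M\to\mathbb N=\{0,1,2,\ldots\}$, a *reduction monoid* if the following hold for all elements of $\mathcal M$: (A1) $(\mathcal M,+)$ is an abelian group and $(a+b)c=ac+bc$. (A2) $|ab|=|a|\,|b|$ and $|a+b|\le\max\{|a|,|b|\}$. (A3) $a\in\mathcal M^*$ if and only if $|a|=1$. (A4) If $ac=bc$ and $|c|>1$, then $a=b$. (A5) If $|a|>1$, $|b|>1$ and there is an element $x\in\mathcal Ma\cap\mathcal Mb$ with $|x|\ne0$, then there is an element $c\in\mathcal M$ such that $\mathcal Ma\cap\mathcal Mb=\mathcal Mc$ and $|c|=\operatorname{lcm}(|a|,|b|)$. (A6) If $\alpha a=\beta b$ with $|\alpha|=i$, $|a|=jk$, $|\beta|=j$, $|b|=ik$, where $i,j,k$ are natural numbers with $ijk\ge1$ and $\gcd(i,j)=1$, then $a=a_1c$ and $b=b_1c$ for some $a_1,b_1,c\in\mathcal M$ with $|c|=k$. **Theorem.** Let $K$ be a field of characteristic zero and let $\mathcal O=K[x^2]x=\{g(x^2)\,x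 : g\in K[x]\}$ be the set of odd polynomials over $K$, a monoid under composition $(p,q)\mapsto p\circ q=p(q(x))$ with identity element $x$. Then $\mathcal O$, with the usual addition of polynomials and with $|\cdot|=\deg$ (where $\deg 0:=0$), is a reduction monoid. -/

import Mathlib

open Polynomial

/-- A reduction monoid. `M` is a multiplicative monoid which is also an abelian group under
`+`, and `size` is the map written `|·|` with values in `ℕ = {0, 1, …}`. The multiplication is not
assumed to be commutative, nor distributive over `+` on the left. The left ideal `M a` is the set
`Set.range (fun m : M => m * a)`. -/
structure IsReductionMonoid (M : Type*) [Monoid M] [AddCommGroup M] (size : M → ℕ) : Prop where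
  /-- right distributivity -/
  add_mul : ∀ a b c : M, (a + b) * c = a * c + b * c
  /-- multiplicativity -/
  size_mul : ∀ a b : M, size (a * b) = size a * size b
  /-- ultrametric inequality -/
  size_add_le : ∀ a b : M, size (a + b) ≤ max (size a) (size b)
  /-- the units are the elements of size one -/
  isUnit_iff : ∀ a : M, IsUnit a ↔ size a = 1
  /-- right cancellation -/
  cancel_right : ∀ a b c : M, 1 < size c → a * c = b * c → a = b
  /-- intersections of principal left ideals -/
  inter_principal : ∀ a b : M, 1 < size a → 1 < size b →
    (∃ x : M, x ∈ Set.range (fun m : M => m * a) ∩ Set.range (fun m : M => m * b) ∧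
      size x ≠ 0) →
    ∃ c : M,
      Set.range (fun m : M => m * a) ∩ Set.range (fun m : M => m * b) =
        Set.range (fun m : M => m * c) ∧
      size c = Nat.lcm (size a) (size b)
  /-- common right factors -/
  common_right_factor : ∀ (α a β b : M) (i j k : ℕ), α * a = β * b →
    size α = i → size a = j * k → size β = j → size b = i * k → 1 ≤ i * j * k →
    Nat.Coprime i j →
    ∃ a₁ b₁ c : M, a = a₁ * c ∧ b = b₁ * c ∧ size c = k

/-- The additive group `K[x²]x` of odd polynomials, i.e. the polynomials `g(x²) x`. -/
def oddPolynomials (K : Type*) [Field K] : AddSubgroup K[X] where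
  carrier := {f | ∃ g : K[X], f = g.comp (X ^ 2) * X}
  zero_mem' := ⟨0, by simp⟩
  add_mem' := by
    rintro _ _ ⟨g, rfl⟩ ⟨h, rfl⟩
    exact ⟨g + h, by rw [add_comp, add_mul]⟩
  neg_mem' := by
    rintro _ ⟨g, rfl⟩
    exact ⟨-g, by rw [neg_comp, neg_mul]⟩

theorem X_mem_oddPolynomials (K : Type*) [Field K] : (X : K[X]) ∈ oddPolynomials K :=
  ⟨1, by simp⟩

theorem comp_mem_oddPolynomials {K : Type*} [Field K] {p q : K[X]}
    (hp : p ∈ oddPolynomials K) (hq : q ∈ oddPolynomials K) : p.comp q ∈ oddPolynomials K := by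
  obtain ⟨g, rfl⟩ := hp
  obtain ⟨h, rfl⟩ := hq
  refine ⟨g.comp (h ^ 2 * X) * h, ?_⟩
  simp only [mul_comp, comp_assoc, pow_comp, X_comp]
  ring_nf

/-- The type of odd polynomials, with the addition of polynomials as `+` and with the composition
of polynomials as multiplication: `p * q = p ∘ q = p(q(x))` and `1 = x`. -/
def OddPolynomial (K : Type*) [Field K] : Type _ := oddPolynomials K

noncomputable instance OddPolynomial.instAddCommGroup (K : Type*) [Field K] :
    AddCommGroup (OddPolynomial K) :=
  inferInstanceAs (AddCommGroup (oddPolynomials K))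

noncomputable instance OddPolynomial.instMonoid (K : Type*) [Field K] :
    Monoid (OddPolynomial K) where
  mul p q := ⟨p.1.comp q.1, comp_mem_oddPolynomials p.2 q.2⟩
  one := ⟨X, X_mem_oddPolynomials K⟩
  mul_assoc p q r := Subtype.ext (comp_assoc p.1 q.1 r.1)
  one_mul p := Subtype.ext (X_comp (p := p.1))
  mul_one p := Subtype.ext (comp_X (p := p.1))

/-- The degree of an odd polynomial as a natural number (the zero polynomial has degree `0`, the
only value compatible with `|0 ∘ c| = |0| |c|`). -/
noncomputable def OddPolynomial.deg {K : Type*} [Field K] (p : OddPolynomial K) : ℕ :=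
  p.1.natDegree

/-!
Everything reduces to statements about composition in `K[X]` and a comparison of degrees.

*Subalgebras with a generator.* If all degrees occurring in a subalgebra `R` of `K[X]` are multiples
of the degree of some `h ∈ R`, then `R = K[h]`, by subtracting multiples of powers of `h`
(`Subalgebra.exists_eq_comp_of_forall_natDegree_dvd`). Both main axioms are reduced to finding an
element of the right degree in a suitable subalgebra.

*Intersections of principal left ideals.* Let `f = α ∘ a = β ∘ b`, all monic, let
`L = lcm (deg a, deg b)` and `N = deg f / L`. In characteristic zero a monic polynomial whose degree
is a multiple of `N` has an approximate `N`-th root (`exists_approximate_root`). If `P` and `Q` are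
the approximate `N`-th roots of `α` and `β`, then `P ∘ a` and `Q ∘ b` both are monic of degree `L`
and their `N`-th powers agree with `f` to such an order that `P ∘ a = Q ∘ b`
(`exists_comp_eq_comp`). Its odd part generates the intersection of the left ideals.

*Common right factors.* Let `α ∘ a = β ∘ b` with `deg α = i` and `deg β = j` coprime, `deg a = j k`
and `deg b = i k`. The algebra `K[a, b]` is spanned by the products `a ^ u * b ^ n * f ^ w` with
`u < i` and `n < j`, whose degrees are distinct multiples of `k`; hence all polynomials in the field
`E = K(a, b)` have degree divisible by `k`. The degree `d` of `K(X)` over `E` divides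
`[K(X) : K(a)] = deg a` and `deg b`, so it divides `k`, and by Gauss's lemma the minimal polynomial of
`X` over `E` has coefficients in `E ∩ K[X]`. Comparing degrees in the equation it gives for `X`
shows that its constant coefficient `c` has degree `k`, and then `E ∩ K[X] = K[c]`
(`exists_common_right_factor`). In characteristic zero a right factor of given degree is unique up to
composition with a linear polynomial on the left, so if `a` is odd and `c(0) = 0` then
`c(X) = -c(-X)` (`mem_oddPolynomials_of_comp_mem`).
-/

/-! ### Subalgebras generated by one element -/

/-- A subalgebra of `K[X]` in which all degrees are multiples of the degree of one of its
elements `h` is `K[h]`. -/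
theorem Subalgebra.exists_eq_comp_of_forall_natDegree_dvd {K : Type*} [Field K]
    (R : Subalgebra K K[X]) {h : K[X]} (hR : h ∈ R) (h0 : 0 < h.natDegree)
    (hdvd : ∀ g ∈ R, h.natDegree ∣ g.natDegree) {g : K[X]} (hg : g ∈ R) :
    ∃ u : K[X], g = u.comp h := by
  induction hn : g.natDegree using Nat.strong_induction_on generalizing g with
  | _ n ih =>
    rcases Nat.eq_zero_or_pos n with rfl | hpos
    · exact ⟨C (g.coeff 0), by rw [C_comp]; exact eq_C_of_natDegree_eq_zero hn⟩
    obtain ⟨m, hm⟩ := hdvd g hg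
    have hh : h ≠ 0 := ne_zero_of_natDegree_gt h0
    have hg0 : g ≠ 0 := ne_zero_of_natDegree_gt (hn ▸ hpos)
    have hc : g.leadingCoeff / h.leadingCoeff ^ m ≠ 0 :=
      div_ne_zero (leadingCoeff_ne_zero.mpr hg0) (pow_ne_zero _ (leadingCoeff_ne_zero.mpr hh))
    set q : K[X] := C (g.leadingCoeff / h.leadingCoeff ^ m) * h ^ m with hq
    have hqdeg : q.natDegree = g.natDegree := by
      rw [hq, natDegree_C_mul hc, natDegree_pow, hm, mul_comm]
    have hqR : q ∈ R := mul_mem (R.algebraMap_mem _) (pow_mem hR m)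
    have hlt : (g - q).natDegree < n := by
      by_cases hz : g - q = 0
      · rwa [hz, natDegree_zero]
      · rw [← hn]
        refine natDegree_lt_natDegree hz (degree_sub_lt_left ?_ hg0 ?_)
        · rw [degree_eq_natDegree hg0, degree_eq_natDegree, hqdeg]
          exact mul_ne_zero (C_ne_zero.mpr hc) (pow_ne_zero _ hh)
        · rw [hq, leadingCoeff_mul, leadingCoeff_C, leadingCoeff_pow,
            div_mul_cancel₀ _ (pow_ne_zero _ (leadingCoeff_ne_zero.mpr hh))]
    obtain ⟨u, hu⟩ := ih _ hlt (sub_mem hg hqR) rfl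
    refine ⟨u + C (g.leadingCoeff / h.leadingCoeff ^ m) * X ^ m, ?_⟩
    rw [add_comp, ← hu, mul_comp, C_comp, pow_comp, X_comp, sub_add_cancel]

/-! ### Approximate roots and common left multiples -/

namespace Polynomial

variable {K : Type*} [Field K]

theorem natDegree_geom_sum₂_le {P Q : K[X]} {p : ℕ} (hP : P.Monic)
    (hQ : Q.Monic) (hPd : P.natDegree = p) (hQd : Q.natDegree = p) (N : ℕ) :
    (∑ i ∈ Finset.range N, P ^ i * Q ^ (N - 1 - i)).natDegree ≤ (N - 1) * p := by
  refine natDegree_sum_le_of_forall_le _ _ fun i hi => ?_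
  rw [(hP.pow _).natDegree_mul (hQ.pow _), hP.natDegree_pow, hQ.natDegree_pow, hPd, hQd,
    ← add_mul]
  have := Finset.mem_range.mp hi
  exact Nat.mul_le_mul_right _ (by omega)

theorem coeff_geom_sum₂ {P Q : K[X]} {p : ℕ} (hP : P.Monic)
    (hQ : Q.Monic) (hPd : P.natDegree = p) (hQd : Q.natDegree = p) (N : ℕ) :
    (∑ i ∈ Finset.range N, P ^ i * Q ^ (N - 1 - i)).coeff ((N - 1) * p) = N := by
  rw [finsetSum_coeff, Finset.sum_congr rfl (g := fun _ => (1 : K)), Finset.sum_const,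
    Finset.card_range, nsmul_eq_mul, mul_one]
  intro i hi
  have hd : (P ^ i * Q ^ (N - 1 - i)).natDegree = (N - 1) * p := by
    rw [(hP.pow _).natDegree_mul (hQ.pow _), hP.natDegree_pow, hQ.natDegree_pow, hPd, hQd,
      ← add_mul]
    have := Finset.mem_range.mp hi
    congr 1; omega
  rw [← hd]
  exact ((hP.pow _).mul (hQ.pow _)).coeff_natDegree

/-- Monic approximate `N`-th roots are unique: `P ^ N - Q ^ N` is `P - Q` times a polynomial of
degree `(N - 1) * p`, because its coefficient `N` there does not vanish. -/
theorem eq_of_degree_pow_sub_pow_lt [CharZero K] {P Q : K[X]} {p N : ℕ} (hN : 0 < N)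
    (hP : P.Monic) (hQ : Q.Monic) (hPd : P.natDegree = p) (hQd : Q.natDegree = p)
    (h : (P ^ N - Q ^ N).degree < ((N - 1) * p : ℕ)) : P = Q := by
  by_contra hne
  have hS : (N : K) ≠ 0 := Nat.cast_ne_zero.mpr hN.ne'
  have h1 : (((N - 1) * p : ℕ) : WithBot ℕ) ≤
      (∑ i ∈ Finset.range N, P ^ i * Q ^ (N - 1 - i)).degree :=
    le_degree_of_ne_zero (by rwa [coeff_geom_sum₂ hP hQ hPd hQd])
  rw [← (Commute.all P Q).geom_sum₂_mul, degree_mul] at h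
  have h2 : (0 : WithBot ℕ) ≤ (P - Q).degree := zero_le_degree_iff.mpr (sub_ne_zero.mpr hne)
  exact absurd h (not_lt.mpr (h1.trans (le_add_of_nonneg_right h2)))

/-- Existence of approximate `N`-th roots. The coefficients are found one after the other, from the
top: adding `r / N * X ^ (p - m - 1)` to `P` changes the coefficient of `P ^ N` at `N * p - m - 1` by
`r`, and no higher one. -/
theorem exists_approximate_root [CharZero K] {α : K[X]} (hα : α.Monic) {N p : ℕ} (hN : 0 < N)
    (hd : α.natDegree = N * p) :
    ∃ P : K[X], P.Monic ∧ P.natDegree = p ∧ (α - P ^ N).degree < ((N - 1) * p : ℕ) := by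
  have hNK : (N : K) ≠ 0 := Nat.cast_ne_zero.mpr hN.ne'
  have hNp : N * p = (N - 1) * p + p := by
    obtain ⟨M, rfl⟩ := Nat.exists_eq_succ_of_ne_zero hN.ne'
    simp [Nat.succ_mul]
  suffices H : ∀ m ≤ p, ∃ P : K[X], P.Monic ∧ P.natDegree = p ∧
      (α - P ^ N).degree < (N * p - m : ℕ) by
    obtain ⟨P, h1, h2, h3⟩ := H p le_rfl
    exact ⟨P, h1, h2, by rwa [hNp, Nat.add_sub_cancel] at h3⟩
  intro m hm
  induction m with
  | zero =>
    refine ⟨X ^ p, monic_X_pow p, natDegree_X_pow p, ?_⟩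
    rw [Nat.sub_zero, ← hd, ← degree_eq_natDegree hα.ne_zero]
    refine degree_sub_lt_left ?_ hα.ne_zero ?_
    · rw [degree_eq_natDegree hα.ne_zero, hd, ← pow_mul, degree_X_pow, mul_comm]
    · rw [hα.leadingCoeff, ((monic_X_pow p).pow N).leadingCoeff]
  | succ m ih =>
    obtain ⟨P, hP, hPd, hlt⟩ := ih (by omega)
    set r := (α - P ^ N).coeff (N * p - (m + 1)) with hr
    set δ : K[X] := C (r / N) * X ^ (p - (m + 1)) with hδ
    have hδd : δ.natDegree ≤ p - (m + 1) := natDegree_C_mul_X_pow_le _ _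
    have hδlt : δ.degree < P.degree := by
      rw [degree_eq_natDegree hP.ne_zero, hPd]
      exact (degree_le_of_natDegree_le hδd).trans_lt (by exact_mod_cast (by omega : p - (m + 1) < p))
    have hP' : (P + δ).Monic := hP.add_of_left hδlt
    have hPd' : (P + δ).natDegree = p := by
      rw [natDegree_add_eq_left_of_degree_lt hδlt, hPd]
    refine ⟨P + δ, hP', hPd', ?_⟩
    have hkey : α - (P + δ) ^ N = α - P ^ N -
        (∑ i ∈ Finset.range N, (P + δ) ^ i * P ^ (N - 1 - i)) * δ := by
      have := (Commute.all (P + δ) P).geom_sum₂_mul N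
      rw [add_sub_cancel_left] at this
      rw [this]; ring
    have hidx : (N - 1) * p + (p - (m + 1)) = N * p - (m + 1) := by omega
    rw [hkey, degree_lt_iff_coeff_zero]
    intro n hn
    rw [coeff_sub]
    rcases hn.eq_or_lt with rfl | hn
    · rw [← hr, ← hidx, coeff_mul_add_eq_of_natDegree_le
        (natDegree_geom_sum₂_le hP' hP hPd' hPd N) hδd,
        coeff_geom_sum₂ hP' hP hPd' hPd N, hδ, coeff_C_mul_X_pow, if_pos rfl,
        mul_div_cancel₀ _ hNK, sub_self]
    · rw [(degree_lt_iff_coeff_zero _ _).mp hlt n (by omega), coeff_eq_zero_of_natDegree_lt,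
        sub_zero]
      refine (natDegree_mul_le_of_le (natDegree_geom_sum₂_le hP' hP hPd' hPd N) hδd).trans_lt ?_
      omega

/-- The monic case of `exists_comp_eq_comp`: `P` and `Q` are the approximate `N`-th roots of `α` and
`β`, where `N` is the quotient of the degree of `α.comp a` by the least common multiple. -/
theorem exists_comp_eq_comp_of_monic [CharZero K] {α β a b : K[X]} (hα : α.Monic) (hβ : β.Monic)
    (ha : a.Monic) (hb : b.Monic) (h : α.comp a = β.comp b) (h0 : 0 < (α.comp a).natDegree) :
    ∃ P Q : K[X], P.comp a = Q.comp b ∧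
      (P.comp a).natDegree = Nat.lcm a.natDegree b.natDegree := by
  have ha' : α.natDegree * a.natDegree = (α.comp a).natDegree := natDegree_comp.symm
  have hb' : β.natDegree * b.natDegree = (α.comp a).natDegree := h ▸ natDegree_comp.symm
  have hapos : 0 < a.natDegree := Nat.pos_of_mul_pos_left (ha' ▸ h0)
  have hbpos : 0 < b.natDegree := Nat.pos_of_mul_pos_left (hb' ▸ h0)
  obtain ⟨N, hN⟩ : Nat.lcm a.natDegree b.natDegree ∣ (α.comp a).natDegree :=
    Nat.lcm_dvd (Dvd.intro_left _ ha') (Dvd.intro_left _ hb')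
  have hNpos : 0 < N := Nat.pos_of_mul_pos_left (hN ▸ h0)
  obtain ⟨p, hp⟩ := Nat.dvd_lcm_left a.natDegree b.natDegree
  obtain ⟨q, hq⟩ := Nat.dvd_lcm_right a.natDegree b.natDegree
  set L := Nat.lcm a.natDegree b.natDegree
  have hαd : α.natDegree = N * p := by
    refine Nat.eq_of_mul_eq_mul_right hapos ?_
    rw [ha', hN, hp]; ring
  have hβd : β.natDegree = N * q := by
    refine Nat.eq_of_mul_eq_mul_right hbpos ?_
    rw [hb', hN, hq]; ring
  have key : ∀ {γ d : K[X]} {s : ℕ}, γ.Monic → d.Monic → 0 < d.natDegree → L = d.natDegree * s →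
      γ.natDegree = N * s → ∃ P : K[X], (P.comp d).Monic ∧ (P.comp d).natDegree = L ∧
        (γ.comp d - (P.comp d) ^ N).degree < ((N - 1) * L : ℕ) := by
    intro γ d s hγ hd hdpos hLs hγd
    obtain ⟨P, hP, hPd, hlt⟩ := exists_approximate_root hγ hNpos hγd
    refine ⟨P, hP.comp hd hdpos.ne', by rw [natDegree_comp, hPd, hLs, mul_comm], ?_⟩
    rw [← pow_comp, ← sub_comp]
    by_cases hz : γ - P ^ N = 0
    · rw [hz, zero_comp, degree_zero]; exact WithBot.bot_lt_coe _
    · refine degree_le_natDegree.trans_lt ?_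
      rw [natDegree_comp]
      rw [degree_eq_natDegree hz] at hlt
      have : (γ - P ^ N).natDegree < (N - 1) * s := by exact_mod_cast hlt
      have := Nat.mul_lt_mul_of_pos_right this hdpos
      have h2 : (N - 1) * s * d.natDegree = (N - 1) * L := by rw [hLs]; ring
      exact_mod_cast h2 ▸ this
  obtain ⟨P, hP, hPd, hPlt⟩ := key hα ha hapos hp hαd
  obtain ⟨Q, hQ, hQd, hQlt⟩ := key hβ hb hbpos hq hβd
  refine ⟨P, Q, eq_of_degree_pow_sub_pow_lt hNpos hP hQ hPd hQd ?_, hPd⟩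
  have : P.comp a ^ N - Q.comp b ^ N =
      (β.comp b - Q.comp b ^ N) - (α.comp a - P.comp a ^ N) := by rw [h]; ring
  rw [this]
  exact (degree_sub_le _ _).trans_lt (max_lt hQlt hPlt)

/-- Two polynomials with a nonconstant common left multiple have one whose degree is the least
common multiple of their degrees. -/
theorem exists_comp_eq_comp [CharZero K] {α β a b : K[X]}
    (h : α.comp a = β.comp b) (h0 : 0 < (α.comp a).natDegree) :
    ∃ P Q : K[X], P.comp a = Q.comp b ∧
      (P.comp a).natDegree = Nat.lcm a.natDegree b.natDegree := by
  have hf : (α.comp a).leadingCoeff ≠ 0 := leadingCoeff_ne_zero.mpr (ne_zero_of_natDegree_gt h0)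
  have key : ∀ {γ d : K[X]}, γ.comp d = α.comp a → ∃ γ' d' : K[X], γ'.Monic ∧ d'.Monic ∧
      γ'.comp d' = C (α.comp a).leadingCoeff⁻¹ * α.comp a ∧ d'.natDegree = d.natDegree ∧
      d' = (C d.leadingCoeff⁻¹ * X : K[X]).comp d := by
    intro γ d hγ
    have hd0 : 0 < d.natDegree := by
      rw [← hγ, natDegree_comp] at h0
      exact Nat.pos_of_mul_pos_left h0
    have hd : d.leadingCoeff ≠ 0 := leadingCoeff_ne_zero.mpr (ne_zero_of_natDegree_gt hd0)
    have hd'm : (C d.leadingCoeff⁻¹ * d).Monic := by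
      rw [Monic, leadingCoeff_mul, leadingCoeff_C, inv_mul_cancel₀ hd]
    have hd'd : (C d.leadingCoeff⁻¹ * d).natDegree = d.natDegree :=
      natDegree_C_mul (inv_ne_zero hd)
    have hcomp : (C (α.comp a).leadingCoeff⁻¹ * γ.comp (C d.leadingCoeff * X)).comp
        (C d.leadingCoeff⁻¹ * d) = C (α.comp a).leadingCoeff⁻¹ * α.comp a := by
      rw [mul_comp, C_comp, comp_assoc, mul_comp, C_comp, X_comp, ← mul_assoc, ← C_mul,
        mul_inv_cancel₀ hd, C_1, one_mul, hγ]
    refine ⟨_, _, ?_, hd'm, hcomp, hd'd, by simp⟩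
    have h1 := congrArg leadingCoeff hcomp
    rw [leadingCoeff_comp (hd'd ▸ hd0.ne'), hd'm.leadingCoeff, one_pow, mul_one, leadingCoeff_mul
      (C _) (α.comp a), leadingCoeff_C, inv_mul_cancel₀ hf] at h1
    exact h1
  obtain ⟨α', a', hα', ha', hc, hd, hl⟩ := key (γ := α) (d := a) rfl
  obtain ⟨β', b', hβ', hb', hc', hd', hl'⟩ := key (γ := β) (d := b) h.symm
  obtain ⟨P, Q, hPQ, hdeg⟩ := exists_comp_eq_comp_of_monic hα' hβ' ha' hb' (hc.trans hc'.symm)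
    (by rwa [hc, natDegree_C_mul (inv_ne_zero hf)])
  refine ⟨P.comp (C a.leadingCoeff⁻¹ * X), Q.comp (C b.leadingCoeff⁻¹ * X), ?_, ?_⟩
  · rw [comp_assoc, comp_assoc, ← hl, ← hl', hPQ]
  · rw [comp_assoc, ← hl, hdeg, hd, hd']

end Polynomial

/-! ### Common right factors of polynomials -/

namespace Polynomial

variable {K : Type*} [Field K]

/-- Reduction of the power `a ^ deg α` by means of the equation that `α` gives for `a`. -/
theorem pow_natDegree_mul_mem (W : Submodule K K[X]) {α a y : K[X]} (hα : α ≠ 0)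
    (hlow : ∀ u < α.natDegree, a ^ u * y ∈ W) (hcomp : α.comp a * y ∈ W) :
    a ^ α.natDegree * y ∈ W := by
  have hsum : α.comp a * y = ∑ u ∈ Finset.range α.natDegree, α.coeff u • (a ^ u * y) +
      α.leadingCoeff • (a ^ α.natDegree * y) := by
    rw [comp, eval₂_eq_sum_range, Finset.sum_range_succ, add_mul, Finset.sum_mul]
    simp only [smul_eq_C_mul, mul_assoc, coeff_natDegree]
  rw [hsum, W.add_mem_iff_right
    (W.sum_mem fun u hu => W.smul_mem _ (hlow u (Finset.mem_range.mp hu)))] at hcomp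
  exact (W.smul_mem_iff (leadingCoeff_ne_zero.mpr hα)).mp hcomp

/-- In a linear combination of polynomials of distinct degrees nothing cancels at the top. -/
theorem dvd_natDegree_of_mem_span {ι : Type*} {v : ι → K[X]} {s : Set ι} {k : ℕ}
    (hinj : Set.InjOn (fun t => (v t).natDegree) s) (hk : ∀ t ∈ s, k ∣ (v t).natDegree)
    {g : K[X]} (hg : g ∈ Submodule.span K (v '' s)) : k ∣ g.natDegree := by
  obtain ⟨l, hl, rfl⟩ := (Finsupp.mem_span_image_iff_linearCombination K).mp hg
  have hls : ∀ t ∈ l.support, t ∈ s := fun t ht => (Finsupp.mem_supported K l).mp hl ht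
  have hdeg : ∀ t ∈ l.support, (l t • v t).natDegree = (v t).natDegree := fun t ht =>
    natDegree_smul _ (Finsupp.mem_support_iff.mp ht)
  rw [Finsupp.linearCombination_apply, Finsupp.sum, natDegree_sum_eq_of_disjoint]
  · refine Finset.sup_induction (dvd_zero k) (fun m hm n hn => ?_) fun t ht => ?_
    · rcases max_choice m n with h | h <;> simpa only [h]
    · rw [hdeg t ht]; exact hk t (hls t ht)
  · rintro t ⟨ht, -⟩ t' ⟨ht', -⟩ hne h
    simp only [Function.comp_apply, hdeg t ht, hdeg t' ht'] at h
    exact hne (hinj (hls t ht) (hls t' ht') h)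

theorem dvd_natDegree_of_mem_adjoin_pair {α β a b : K[X]} {k : ℕ} (hab : α.comp a = β.comp b)
    (hα : 0 < α.natDegree) (hβ : 0 < β.natDegree) (hk : 0 < k)
    (hcop : Nat.Coprime α.natDegree β.natDegree)
    (ha : a.natDegree = β.natDegree * k) (hb : b.natDegree = α.natDegree * k)
    {g : K[X]} (hg : g ∈ Algebra.adjoin K {a, b}) : k ∣ g.natDegree := by
  set i := α.natDegree with hi
  set j := β.natDegree with hj
  set v : ℕ × ℕ × ℕ → K[X] := fun t => a ^ t.1 * b ^ t.2.1 * α.comp a ^ t.2.2 with hv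
  set s : Set (ℕ × ℕ × ℕ) := {t | t.1 < i ∧ t.2.1 < j} with hs
  set W := Submodule.span K (v '' s) with hW
  have ha0 : a ≠ 0 := ne_zero_of_natDegree_gt (n := 0) (ha ▸ Nat.mul_pos hβ hk)
  have hb0 : b ≠ 0 := ne_zero_of_natDegree_gt (n := 0) (hb ▸ Nat.mul_pos hα hk)
  have hfd : (α.comp a).natDegree = i * (j * k) := by rw [natDegree_comp, ha]
  have hf0 : α.comp a ≠ 0 :=
    ne_zero_of_natDegree_gt (n := 0) (hfd ▸ Nat.mul_pos hα (Nat.mul_pos hβ hk))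
  have hdeg : ∀ t, (v t).natDegree = k * (t.1 * j + t.2.1 * i + t.2.2 * (i * j)) := by
    intro t
    rw [hv]
    simp only
    rw [natDegree_mul (mul_ne_zero (pow_ne_zero _ ha0) (pow_ne_zero _ hb0)) (pow_ne_zero _ hf0),
      natDegree_mul (pow_ne_zero _ ha0) (pow_ne_zero _ hb0), natDegree_pow, natDegree_pow,
      natDegree_pow, ha, hb, hfd]
    ring
  have hgen : ∀ u < i, ∀ n < j, ∀ w, a ^ u * b ^ n * α.comp a ^ w ∈ W := fun u hu n hn w =>
    Submodule.subset_span ⟨(u, n, w), ⟨hu, hn⟩, rfl⟩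
  have hone : (1 : K[X]) ∈ W := by simpa using hgen 0 hα 0 hβ 0
  have hmula : ∀ y ∈ W, a * y ∈ W := by
    intro y hy
    induction hy using Submodule.span_induction with
    | zero => simp
    | add x y _ _ hx hy => rw [mul_add]; exact W.add_mem hx hy
    | smul c x _ hx => rw [mul_smul_comm]; exact W.smul_mem c hx
    | mem y hy =>
      obtain ⟨⟨u, n, w⟩, ⟨hu, hn⟩, rfl⟩ := hy
      have e : a * (a ^ u * b ^ n * α.comp a ^ w) = a ^ (u + 1) * (b ^ n * α.comp a ^ w) := by ring
      change a * (a ^ u * b ^ n * α.comp a ^ w) ∈ W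
      rw [e]
      rcases (Nat.succ_le_of_lt hu).lt_or_eq with h | h
      · rw [← mul_assoc]; exact hgen _ h _ hn _
      · rw [← Nat.succ_eq_add_one, h]
        refine pow_natDegree_mul_mem W (ne_zero_of_natDegree_gt hα) (fun u hu => ?_) ?_
        · rw [← mul_assoc]; exact hgen _ hu _ hn _
        · have := hgen 0 hα n hn (w + 1)
          convert this using 1; ring
  have hmulb : ∀ y ∈ W, b * y ∈ W := by
    intro y hy
    induction hy using Submodule.span_induction with
    | zero => simp
    | add x y _ _ hx hy => rw [mul_add]; exact W.add_mem hx hy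
    | smul c x _ hx => rw [mul_smul_comm]; exact W.smul_mem c hx
    | mem y hy =>
      obtain ⟨⟨u, n, w⟩, ⟨hu, hn⟩, rfl⟩ := hy
      have e : b * (a ^ u * b ^ n * α.comp a ^ w) = b ^ (n + 1) * (a ^ u * α.comp a ^ w) := by ring
      change b * (a ^ u * b ^ n * α.comp a ^ w) ∈ W
      rw [e]
      have e2 : ∀ n, b ^ n * (a ^ u * α.comp a ^ w) = a ^ u * b ^ n * α.comp a ^ w := by
        intro n; ring
      rcases (Nat.succ_le_of_lt hn).lt_or_eq with h | h
      · rw [e2]; exact hgen _ hu _ h _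
      · rw [← Nat.succ_eq_add_one, h]
        refine pow_natDegree_mul_mem W (ne_zero_of_natDegree_gt hβ) (fun n hn => ?_) ?_
        · rw [e2]; exact hgen _ hu _ hn _
        · rw [← hab]
          have := hgen u hu 0 hβ (w + 1)
          convert this using 1; ring
  -- `W` contains `1` and is stable under multiplication by `a` and `b`, so it contains `K[a, b]`
  have hmul : ∀ y ∈ W, g * y ∈ W := by
    induction hg using Algebra.adjoin_induction with
    | mem x hx =>
      rcases hx with rfl | rfl
      · exact hmula
      · exact hmulb
    | algebraMap c => intro y hy; rw [← Algebra.smul_def]; exact W.smul_mem c hy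
    | add x y _ _ hx hy => intro z hz; rw [add_mul]; exact W.add_mem (hx z hz) (hy z hz)
    | mul x y _ _ hx hy => intro z hz; rw [mul_assoc]; exact hx _ (hy z hz)
  have hgW : g ∈ W := by simpa using hmul 1 hone
  refine dvd_natDegree_of_mem_span ?_ (fun t _ => hdeg t ▸ dvd_mul_right k _) hgW
  rintro ⟨u, n, w⟩ ⟨hu, hn⟩ ⟨u', n', w'⟩ ⟨hu', hn'⟩ h
  simp only [hdeg] at h hu hn hu' hn'
  have h := Nat.eq_of_mul_eq_mul_left hk h
  -- the degree determines `u` modulo `i` and `n` modulo `j`, and then `w`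
  have hu_eq : u = u' := by
    have h1 : u * j ≡ u' * j [MOD i] := by
      have := congrArg (· % i) h
      simpa [Nat.ModEq, Nat.add_mod, Nat.mul_mod] using this
    have := Nat.ModEq.cancel_right_of_coprime hcop h1
    rwa [Nat.ModEq, Nat.mod_eq_of_lt hu, Nat.mod_eq_of_lt hu'] at this
  have hn_eq : n = n' := by
    have h1 : n * i ≡ n' * i [MOD j] := by
      have := congrArg (· % j) h
      simpa [Nat.ModEq, Nat.add_mod, Nat.mul_mod] using this
    have := Nat.ModEq.cancel_right_of_coprime hcop.symm h1
    rwa [Nat.ModEq, Nat.mod_eq_of_lt hn, Nat.mod_eq_of_lt hn'] at this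
  subst hu_eq hn_eq
  have := Nat.eq_of_mul_eq_mul_right (Nat.mul_pos hα hβ) (Nat.add_left_cancel h)
  rw [this]

/-- In a monic equation of degree at most `k` for `X`, with coefficients of degrees divisible by `k`,
only the leading and the constant term can have the same degree, so they have to balance. -/
theorem exists_natDegree_eq_of_eval_X_eq_zero {M : K[X][X]} {k : ℕ} (hM : M.Monic)
    (hd0 : 0 < M.natDegree) (hdk : M.natDegree ≤ k) (hcoeff : ∀ m, k ∣ (M.coeff m).natDegree)
    (hroot : M.eval X = 0) : (M.coeff 0).natDegree = k := by
  by_contra hne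
  rw [eval_eq_sum_range] at hroot
  have hdeg : ∀ m, M.coeff m * X ^ m ≠ 0 →
      (M.coeff m * X ^ m).natDegree = (M.coeff m).natDegree + m := by
    intro m hm
    exact natDegree_mul_X_pow m (left_ne_zero_of_mul hm)
  have htop : (M.coeff M.natDegree).natDegree = 0 := by
    rw [coeff_natDegree, hM.leadingCoeff, natDegree_one]
  -- `k` divides `m' - m ≤ k`, so equality of degrees forces `m = 0` and `m' = k`
  have hdisj : ∀ m m', m < m' → m' ≤ M.natDegree →
      (M.coeff m).natDegree + m ≠ (M.coeff m').natDegree + m' := by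
    intro m m' hlt hle he
    have h1 : k ∣ m' - m := by
      have h2 := Nat.dvd_sub (hcoeff m) (hcoeff m')
      rwa [show (M.coeff m).natDegree - (M.coeff m').natDegree = m' - m by omega] at h2
    have h3 := Nat.le_of_dvd (by omega) h1
    obtain rfl : m = 0 := by omega
    obtain rfl : m' = M.natDegree := by omega
    omega
  have h := natDegree_sum_eq_of_disjoint (fun m => M.coeff m * X ^ m)
    (Finset.range (M.natDegree + 1)) (by
      rintro m ⟨hm, hm0⟩ m' ⟨hm', hm0'⟩ hmm he
      simp only [Function.comp_apply, hdeg m hm0, hdeg m' hm0'] at he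
      have := Finset.mem_range.mp hm
      have := Finset.mem_range.mp hm'
      rcases Nat.lt_or_gt_of_ne hmm with hlt | hlt
      · exact hdisj _ _ hlt (by omega) he
      · exact hdisj _ _ hlt (by omega) he.symm)
  rw [hroot, natDegree_zero] at h
  have h2 := Finset.le_sup (f := fun m => (M.coeff m * X ^ m).natDegree)
    (Finset.self_mem_range_succ M.natDegree)
  simp only [coeff_natDegree, hM.leadingCoeff, one_mul, natDegree_X_pow] at h2
  omega

/-- Polynomials `a`, `b` with a common left multiple whose degree is the least common multiple of
their degrees have a common right factor whose degree is the greatest common divisor. This holds in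
every characteristic. -/
theorem exists_common_right_factor {α β a b : K[X]} {k : ℕ} (hab : α.comp a = β.comp b)
    (hα : 0 < α.natDegree) (hβ : 0 < β.natDegree) (hk : 0 < k)
    (hcop : Nat.Coprime α.natDegree β.natDegree)
    (ha : a.natDegree = β.natDegree * k) (hb : b.natDegree = α.natDegree * k) :
    ∃ a₁ b₁ c : K[X], a = a₁.comp c ∧ b = b₁.comp c ∧ c.natDegree = k := by
  let φ : K[X] →ₐ[K] RatFunc K := Algebra.algHom K K[X] (RatFunc K)
  have hφ : Function.Injective φ := RatFunc.algebraMap_injective K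
  let E : IntermediateField K (RatFunc K) := IntermediateField.adjoin K {φ a, φ b}
  have haE : φ a ∈ E := IntermediateField.subset_adjoin K _ (by simp)
  have hbE : φ b ∈ E := IntermediateField.subset_adjoin K _ (by simp)
  have hapos : 0 < a.natDegree := ha ▸ Nat.mul_pos hβ hk
  -- a polynomial in `E` is a quotient of two elements of `K[a, b]`
  have hE : ∀ p : K[X], φ p ∈ E → k ∣ p.natDegree := by
    intro p hp
    obtain ⟨r, hr, s, hs, hrs⟩ := IntermediateField.mem_adjoin_iff_div.mp hp
    have him : ({φ a, φ b} : Set (RatFunc K)) = φ '' {a, b} := by rw [Set.image_pair]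
    rw [him, ← AlgHom.map_adjoin] at hr hs
    obtain ⟨r, hr, rfl⟩ := hr
    obtain ⟨s, hs, rfl⟩ := hs
    by_cases hp0 : p = 0
    · simp [hp0]
    by_cases hs0 : s = 0
    · subst hs0
      simp only [AlgHom.coe_toRingHom, map_zero, div_zero] at hrs
      exact absurd (hφ (hrs.trans (map_zero φ).symm)) hp0
    have hmul : p * s = r := by
      apply hφ
      rw [map_mul, hrs]
      exact div_mul_cancel₀ _ ((map_ne_zero_iff φ hφ).mpr hs0)
    have hdr := dvd_natDegree_of_mem_adjoin_pair hab hα hβ hk hcop ha hb hr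
    have hds := dvd_natDegree_of_mem_adjoin_pair hab hα hβ hk hcop ha hb hs
    rw [← hmul, natDegree_mul hp0 hs0] at hdr
    exact (Nat.dvd_add_left hds).mp hdr
  have hfin : ∀ p : K[X], φ p ∈ E → Module.finrank E (RatFunc K) ∣ p.natDegree := by
    intro p hp
    have h1 : IntermediateField.adjoin K {φ p} ≤ E := by
      rw [IntermediateField.adjoin_le_iff]; simpa using hp
    have h2 := IntermediateField.finrank_dvd_of_le_left h1
    rw [RatFunc.finrank_eq_max_natDegree] at h2
    have h3 : (φ p).num = p := RatFunc.num_algebraMap p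
    have h4 : (φ p).denom = 1 := RatFunc.denom_algebraMap p
    rwa [h3, h4, natDegree_one, Nat.max_zero] at h2
  have hEbot : E ≠ ⊥ := by
    intro h
    rw [h] at haE
    obtain ⟨c, hc⟩ := IntermediateField.mem_bot.mp haE
    have : C c = a := hφ (by rw [← hc]; exact φ.commutes c)
    rw [← this, natDegree_C] at hapos
    exact absurd hapos (lt_irrefl 0)
  have hint : IsIntegral E (RatFunc.X : RatFunc K) :=
    (RatFunc.IntermediateField.isAlgebraic_X hEbot).isIntegral
  have hdeg : (minpoly E (RatFunc.X : RatFunc K)).natDegree = Module.finrank E (RatFunc K) := by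
    rw [← (RatFunc.IntermediateField.adjoinXEquiv E).toLinearEquiv.finrank_eq,
      IntermediateField.adjoin.finrank hint]
  have hdk : Module.finrank E (RatFunc K) ∣ k := by
    have h1 := Nat.dvd_gcd (hfin a haE) (hfin b hbE)
    rwa [ha, hb, Nat.gcd_mul_right, Nat.Coprime.gcd_eq_one hcop.symm, one_mul] at h1
  -- The minimal polynomial of `X` divides `a(Y) - a(X)`, up to a scalar a monic polynomial in `Y`
  -- over `K[X]`, so Gauss's lemma gives that its coefficients are polynomials.
  let F : K[X][X] := C (C a.leadingCoeff⁻¹) * (a.map C - C a)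
  have hlc : a.leadingCoeff ≠ 0 := leadingCoeff_ne_zero.mpr (ne_zero_of_natDegree_gt hapos)
  have hF : F.Monic := by
    have hd : (C a : K[X][X]).degree < (a.map C).degree := by
      refine degree_C_le.trans_lt ?_
      rw [degree_map_eq_of_injective C_injective]
      exact natDegree_pos_iff_degree_pos.mp hapos
    rw [Monic, leadingCoeff_mul, leadingCoeff_C, leadingCoeff_sub_of_degree_lt hd,
      leadingCoeff_map_of_injective C_injective, ← C_mul, inv_mul_cancel₀ hlc, C_1]
  let FE : E[X] := C (algebraMap K E a.leadingCoeff⁻¹) * (a.map (algebraMap K E) - C ⟨φ a, haE⟩)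
  have hFE : FE.map (algebraMap E (RatFunc K)) = F.map (algebraMap K[X] (RatFunc K)) := by
    simp only [FE, F, Polynomial.map_mul, Polynomial.map_sub, map_C, Polynomial.map_map]
    rfl
  have hroot : aeval (RatFunc.X : RatFunc K) FE = 0 := by
    rw [aeval_def, ← eval_map, hFE, ← RatFunc.algebraMap_X, eval_map, eval₂_hom]
    simp only [F, eval_mul, eval_C, eval_sub, eval_map]
    rw [show eval₂ C X a = a from eval₂_C_X, sub_self, mul_zero, map_zero]
  have hdvd : (minpoly E (RatFunc.X : RatFunc K)).map (algebraMap E (RatFunc K)) ∣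
      F.map (algebraMap K[X] (RatFunc K)) := by
    rw [← hFE]
    exact Polynomial.map_dvd _ (minpoly.dvd E _ hroot)
  obtain ⟨M, hM⟩ := IsIntegrallyClosed.eq_map_mul_C_of_dvd (RatFunc K) hF hdvd
  have hminm := minpoly.monic hint
  rw [(hminm.map _).leadingCoeff, C_1, mul_one] at hM
  have hinj : Function.Injective (algebraMap K[X] (RatFunc K)) := RatFunc.algebraMap_injective K
  have hMm : M.Monic := monic_of_injective hinj (hM ▸ hminm.map _)
  have hMd : M.natDegree = Module.finrank E (RatFunc K) := by
    rw [← hdeg, ← natDegree_map_eq_of_injective hinj, hM, natDegree_map]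
  have hMc : ∀ m, φ (M.coeff m) ∈ E := by
    intro m
    have h1 : algebraMap K[X] (RatFunc K) (M.coeff m) = _ := (coeff_map _ m).symm
    rw [hM, coeff_map] at h1
    change algebraMap K[X] (RatFunc K) (M.coeff m) ∈ E
    rw [h1]
    exact ((minpoly E (RatFunc.X : RatFunc K)).coeff m).2
  have hMroot : M.eval X = 0 := by
    apply hinj
    rw [← eval₂_hom, RatFunc.algebraMap_X, ← eval_map, hM, eval_map, ← aeval_def, minpoly.aeval,
      map_zero]
  have hck : (M.coeff 0).natDegree = k :=
    exists_natDegree_eq_of_eval_X_eq_zero hMm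
      (hMd ▸ Nat.pos_of_dvd_of_pos hdk hk) (hMd ▸ Nat.le_of_dvd hk hdk) (fun m => hE _ (hMc m))
      hMroot
  have key : ∀ g : K[X], φ g ∈ E → ∃ u : K[X], g = u.comp (M.coeff 0) := fun g hg =>
    (E.toSubalgebra.comap φ).exists_eq_comp_of_forall_natDegree_dvd (hMc 0) (hck ▸ hk)
      (fun p hp => hck ▸ hE p hp) hg
  obtain ⟨a₁, ha₁⟩ := key a haE
  obtain ⟨b₁, hb₁⟩ := key b hbE
  exact ⟨a₁, b₁, _, ha₁, hb₁, hck⟩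

end Polynomial

/-! ### Odd polynomials -/

namespace Polynomial

variable {K : Type*} [Field K]

theorem comp_neg_X_coeff (p : K[X]) (n : ℕ) : (p.comp (-X)).coeff n = (-1) ^ n * p.coeff n := by
  rw [show (-X : K[X]) = C (-1) * X by simp, comp_C_mul_X_coeff, mul_comm]

theorem odd_natDegree_of_mem_oddPolynomials {p : K[X]} (hp : p ∈ oddPolynomials K) (h0 : p ≠ 0) :
    Odd p.natDegree := by
  obtain ⟨g, rfl⟩ := hp
  have hg : g.comp (X ^ 2) ≠ 0 := left_ne_zero_of_mul h0
  rw [natDegree_mul_X hg, natDegree_comp, natDegree_X_pow]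
  exact (even_two.mul_left _).add_one

theorem eval_zero_of_mem_oddPolynomials {p : K[X]} (hp : p ∈ oddPolynomials K) : p.eval 0 = 0 := by
  obtain ⟨g, rfl⟩ := hp
  simp

theorem eq_of_comp_eq_comp {p q c : K[X]} (hc : 0 < c.natDegree) (h : p.comp c = q.comp c) :
    p = q := by
  rw [← sub_eq_zero, ← sub_comp, comp_eq_zero_iff] at h
  rcases h with h | ⟨-, h⟩
  · exact sub_eq_zero.mp h
  · rw [h, natDegree_C] at hc
    exact absurd hc (lt_irrefl 0)

theorem natDegree_comp_neg_X (p : K[X]) : (p.comp (-X)).natDegree = p.natDegree := by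
  rw [natDegree_comp, natDegree_neg, natDegree_X, mul_one]

variable [CharZero K]

theorem mem_oddPolynomials_iff_comp_neg_X {p : K[X]} :
    p ∈ oddPolynomials K ↔ p.comp (-X) = -p := by
  constructor
  · rintro ⟨g, rfl⟩
    simp [comp_assoc]
  · intro h
    have hcoeff : ∀ n, p.coeff (2 * n) = 0 := by
      intro n
      have h1 := congrArg (fun q => coeff q (2 * n)) h
      simp only [comp_neg_X_coeff, coeff_neg, pow_mul, neg_one_sq, one_pow, one_mul] at h1
      exact self_eq_neg.mp h1
    refine ⟨contract 2 (divX p), ?_⟩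
    rw [← expand_eq_comp_X_pow]
    ext n
    cases n with
    | zero => rw [mul_coeff_zero, coeff_X_zero, mul_zero]; exact hcoeff 0
    | succ n =>
      rw [coeff_mul_X, coeff_expand two_pos]
      split_ifs with hn
      · rw [coeff_contract two_ne_zero, Nat.div_mul_cancel hn, coeff_divX]
      · obtain ⟨m, hm⟩ : 2 ∣ n + 1 := by omega
        rw [hm]; exact hcoeff m

theorem mem_oddPolynomials_of_comp {p c : K[X]} (hc : c ∈ oddPolynomials K)
    (hpc : p.comp c ∈ oddPolynomials K) (h0 : 0 < c.natDegree) : p ∈ oddPolynomials K := by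
  rw [mem_oddPolynomials_iff_comp_neg_X] at hc hpc ⊢
  refine eq_of_comp_eq_comp h0 ?_
  rw [comp_assoc, neg_comp, X_comp, ← hc, ← comp_assoc, hpc, neg_comp]

/-- A right factor `c` of odd degree of an odd polynomial is odd once `c(0) = 0`: both `c(X)` and
`-c(-X)` are right factors of that degree with the same leading coefficient, and
`exists_comp_eq_comp` relates them by linear polynomials. -/
theorem mem_oddPolynomials_of_comp_mem {p c : K[X]} (hp : p.comp c ∈ oddPolynomials K)
    (hpos : 0 < (p.comp c).natDegree) (hodd : Odd c.natDegree) (hc0 : c.eval 0 = 0) :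
    c ∈ oddPolynomials K := by
  have hcpos : 0 < c.natDegree := hodd.pos
  set d : K[X] := -c.comp (-X) with hd
  have hdd : d.natDegree = c.natDegree := by rw [hd, natDegree_neg, natDegree_comp_neg_X]
  have hd0 : d.eval 0 = 0 := by simp [hd, eval_comp, hc0]
  have hlead : d.leadingCoeff = c.leadingCoeff := by
    rw [leadingCoeff, hdd, hd, coeff_neg, comp_neg_X_coeff, hodd.neg_one_pow, neg_one_mul, neg_neg,
      leadingCoeff]
  have hfac : p.comp c = (-p.comp (-X)).comp d := by
    rw [neg_comp, comp_assoc, neg_comp, X_comp, hd, neg_neg, ← comp_assoc,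
      mem_oddPolynomials_iff_comp_neg_X.mp hp, neg_neg]
  obtain ⟨P, Q, hPQ, hdeg⟩ := exists_comp_eq_comp hfac hpos
  rw [hdd, Nat.lcm_self] at hdeg
  have hQdeg : (Q.comp d).natDegree = c.natDegree := hPQ ▸ hdeg
  rw [natDegree_comp] at hdeg hQdeg
  rw [hdd] at hQdeg
  have hP1 : P.natDegree = 1 := Nat.eq_of_mul_eq_mul_right hcpos (hdeg.trans (one_mul _).symm)
  have hQ1 : Q.natDegree = 1 := Nat.eq_of_mul_eq_mul_right hcpos (hQdeg.trans (one_mul _).symm)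
  have hPX := eq_X_add_C_of_natDegree_le_one hP1.le
  have hQX := eq_X_add_C_of_natDegree_le_one hQ1.le
  have hlc := congrArg leadingCoeff hPQ
  rw [leadingCoeff_comp hcpos.ne', leadingCoeff_comp (hdd ▸ hcpos.ne'), hP1, hQ1, hlead] at hlc
  have hcl : c.leadingCoeff ≠ 0 := leadingCoeff_ne_zero.mpr (ne_zero_of_natDegree_gt hcpos)
  have h1 : P.coeff 1 = Q.coeff 1 := by
    have := mul_right_cancel₀ (pow_ne_zero 1 hcl) hlc
    rwa [leadingCoeff, leadingCoeff, hP1, hQ1] at this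
  have h1' : P.coeff 1 ≠ 0 := by
    have : P.leadingCoeff ≠ 0 :=
      leadingCoeff_ne_zero.mpr (ne_zero_of_natDegree_gt (n := 0) (by omega))
    rwa [leadingCoeff, hP1] at this
  have h0 : P.coeff 0 = Q.coeff 0 := by
    have := congrArg (eval 0) hPQ
    rwa [eval_comp, eval_comp, hc0, hd0, ← coeff_zero_eq_eval_zero, ← coeff_zero_eq_eval_zero]
      at this
  have hPQ' : P = Q := by rw [hPX, hQX, h1, h0]
  have hcd : c = d := by
    rw [← hPQ', hPX] at hPQ
    simp only [add_comp, mul_comp, C_comp, X_comp, add_left_inj] at hPQ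
    exact mul_left_cancel₀ (C_ne_zero.mpr h1') hPQ
  rw [mem_oddPolynomials_iff_comp_neg_X]
  exact (neg_eq_iff_eq_neg.mp (hd.symm.trans hcd.symm))

/-- The odd part of a common left multiple as in `exists_comp_eq_comp` is again one; it keeps the
degree, which is odd. -/
theorem exists_odd_common_multiple {α β a b : K[X]} (ha : a ∈ oddPolynomials K)
    (hb : b ∈ oddPolynomials K) (h : α.comp a = β.comp b) (h0 : 0 < (α.comp a).natDegree)
    (hodd : Odd (Nat.lcm a.natDegree b.natDegree)) :
    ∃ P ∈ oddPolynomials K, ∃ Q ∈ oddPolynomials K, P.comp a = Q.comp b ∧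
      (P.comp a).natDegree = Nat.lcm a.natDegree b.natDegree := by
  obtain ⟨P, Q, hPQ, hdeg⟩ := exists_comp_eq_comp h h0
  have hmem : ∀ R : K[X], R - R.comp (-X) ∈ oddPolynomials K := by
    intro R
    rw [mem_oddPolynomials_iff_comp_neg_X, sub_comp, comp_assoc, neg_comp, X_comp, neg_neg, comp_X,
      neg_sub]
  have hcomp : ∀ {R d : K[X]}, d ∈ oddPolynomials K →
      (R - R.comp (-X)).comp d = R.comp d - (R.comp d).comp (-X) := by
    intro R d hd
    rw [sub_comp, comp_assoc, comp_assoc, neg_comp, X_comp,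
      mem_oddPolynomials_iff_comp_neg_X.mp hd]
  refine ⟨_, hmem P, _, hmem Q, by rw [hcomp ha, hcomp hb, hPQ], ?_⟩
  rw [hcomp ha, ← hdeg]
  refine natDegree_eq_of_le_of_coeff_ne_zero ?_ ?_
  · refine (natDegree_sub_le _ _).trans ?_
    rw [natDegree_comp_neg_X, max_self]
  · rw [coeff_sub, comp_neg_X_coeff, hdeg, hodd.neg_one_pow, neg_one_mul, sub_neg_eq_add,
      ← two_mul, ← hdeg, coeff_natDegree]
    refine mul_ne_zero two_ne_zero (leadingCoeff_ne_zero.mpr ?_)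
    exact ne_zero_of_natDegree_gt (n := 0) (hdeg ▸ hodd.pos)

theorem exists_odd_common_right_factor {α β a b : K[X]} {k : ℕ} (ha : a ∈ oddPolynomials K)
    (hb : b ∈ oddPolynomials K) (hab : α.comp a = β.comp b)
    (hα : 0 < α.natDegree) (hβ : 0 < β.natDegree) (hk : 0 < k)
    (hcop : Nat.Coprime α.natDegree β.natDegree)
    (had : a.natDegree = β.natDegree * k) (hbd : b.natDegree = α.natDegree * k) :
    ∃ a₁ ∈ oddPolynomials K, ∃ b₁ ∈ oddPolynomials K, ∃ c ∈ oddPolynomials K,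
      a = a₁.comp c ∧ b = b₁.comp c ∧ c.natDegree = k := by
  obtain ⟨a₁, b₁, c, rfl, rfl, hc⟩ := exists_common_right_factor hab hα hβ hk hcop had hbd
  -- oddness needs `c(0) = 0`, so the constant term is moved into the left factors
  set t := C (c.eval 0) with ht
  have hshift : ∀ p : K[X], p.comp c = (p.comp (X + t)).comp (c - t) := by
    intro p
    rw [comp_assoc, add_comp, X_comp, ht, C_comp, sub_add_cancel]
  have hcd : (c - t).natDegree = k := by rw [ht, natDegree_sub_C, hc]
  have hapos : 0 < (a₁.comp c).natDegree := had ▸ Nat.mul_pos hβ hk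
  have hkodd : Odd k := by
    have h1 := odd_natDegree_of_mem_oddPolynomials ha (ne_zero_of_natDegree_gt hapos)
    rw [had] at h1
    exact (Nat.odd_mul.mp h1).2
  have hct : c - t ∈ oddPolynomials K :=
    mem_oddPolynomials_of_comp_mem (hshift a₁ ▸ ha) (hshift a₁ ▸ hapos) (hcd.symm ▸ hkodd)
      (by simp [ht])
  refine ⟨_, mem_oddPolynomials_of_comp hct (hshift a₁ ▸ ha) (hcd ▸ hk), _,
    mem_oddPolynomials_of_comp hct (hshift b₁ ▸ hb) (hcd ▸ hk), _, hct, hshift a₁, hshift b₁, hcd⟩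

end Polynomial

/-! ### The monoid of odd polynomials -/

namespace OddPolynomial

variable {K : Type*} [Field K]

theorem deg_mul (p q : OddPolynomial K) : (p * q).deg = p.deg * q.deg := natDegree_comp

theorem mul_right_cancel_of_deg_pos {p q c : OddPolynomial K} (hc : 0 < c.deg)
    (h : p * c = q * c) : p = q :=
  Subtype.ext (eq_of_comp_eq_comp hc (congrArg Subtype.val h))

theorem isUnit_iff_deg_eq_one (p : OddPolynomial K) : IsUnit p ↔ p.deg = 1 := by
  have hone : (1 : OddPolynomial K).deg = 1 := natDegree_X
  constructor
  · rintro ⟨u, rfl⟩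
    have h := deg_mul u.1 u.2
    rw [u.val_inv, hone] at h
    exact Nat.eq_one_of_mul_eq_one_right h.symm
  · obtain ⟨f, hf⟩ := p
    intro h
    replace h : f.natDegree = 1 := h
    obtain ⟨r, hr, rfl⟩ : ∃ r : K, r ≠ 0 ∧ f = C r * X := by
      refine ⟨f.coeff 1, ?_, ?_⟩
      · rw [← h, coeff_natDegree, leadingCoeff_ne_zero]
        exact ne_zero_of_natDegree_gt (n := 0) (by omega)
      · have h2 := eq_X_add_C_of_natDegree_le_one h.le
        rwa [coeff_zero_eq_eval_zero f, eval_zero_of_mem_oddPolynomials hf, C_0, add_zero] at h2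
    have hC : ∀ s t : K, s * t = 1 → (C s * X : K[X]).comp (C t * X) = X := by
      intro s t hst
      rw [mul_comp, C_comp, X_comp, ← mul_assoc, ← C_mul, hst, C_1, one_mul]
    refine isUnit_iff_exists.mpr ⟨⟨C r⁻¹ * X, C r⁻¹, by rw [C_comp]⟩, Subtype.ext ?_, Subtype.ext ?_⟩
    · exact hC _ _ (mul_inv_cancel₀ hr)
    · exact hC _ _ (inv_mul_cancel₀ hr)

theorem exists_inter_eq_range [CharZero K] (a b : OddPolynomial K) (ha : 1 < a.deg) (hb : 1 < b.deg)
    (hx : ∃ x : OddPolynomial K,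
      x ∈ Set.range (fun m => m * a) ∩ Set.range (fun m => m * b) ∧ x.deg ≠ 0) :
    ∃ c : OddPolynomial K,
      Set.range (fun m => m * a) ∩ Set.range (fun m => m * b) = Set.range (fun m => m * c) ∧
      c.deg = Nat.lcm a.deg b.deg := by
  obtain ⟨x, ⟨⟨α, rfl⟩, ⟨β, hβ⟩⟩, hx0⟩ := hx
  have ha0 : 0 < a.1.natDegree := zero_lt_one.trans ha
  have hb0 : 0 < b.1.natDegree := zero_lt_one.trans hb
  have hodd : Odd (Nat.lcm a.1.natDegree b.1.natDegree) := by
    have h1 := odd_natDegree_of_mem_oddPolynomials a.2 (ne_zero_of_natDegree_gt ha0)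
    have h2 := odd_natDegree_of_mem_oddPolynomials b.2 (ne_zero_of_natDegree_gt hb0)
    exact (Nat.odd_mul.mpr ⟨h1, h2⟩).of_dvd_nat (Nat.lcm_dvd_mul _ _)
  obtain ⟨P, hP, Q, hQ, hPQ, hdeg⟩ := exists_odd_common_multiple a.2 b.2
    (congrArg Subtype.val hβ.symm) (Nat.pos_of_ne_zero hx0) hodd
  let p : OddPolynomial K := ⟨P, hP⟩
  let q : OddPolynomial K := ⟨Q, hQ⟩
  have hpq : p * a = q * b := Subtype.ext hPQ
  refine ⟨p * a, ?_, hdeg⟩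
  ext z
  constructor
  · rintro ⟨⟨u, rfl⟩, ⟨v, hv⟩⟩
    have hcpos : 0 < (P.comp a.1).natDegree := hdeg ▸ hodd.pos
    -- `K[a] ∩ K[b]`, whose degrees are common multiples of `deg a` and `deg b`
    let R : Subalgebra K K[X] := (aeval (R := K) a.1).range ⊓ (aeval (R := K) b.1).range
    have hR : ∀ g ∈ R, (P.comp a.1).natDegree ∣ g.natDegree := by
      rintro g ⟨⟨s, hs⟩, ⟨t, ht⟩⟩
      rw [hdeg]
      refine Nat.lcm_dvd ?_ ?_
      · rw [← hs]; exact Dvd.intro_left _ natDegree_comp.symm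
      · rw [← ht]; exact Dvd.intro_left _ natDegree_comp.symm
    obtain ⟨w, hw⟩ := R.exists_eq_comp_of_forall_natDegree_dvd (h := P.comp a.1)
      ⟨⟨P, rfl⟩, ⟨Q, hPQ.symm⟩⟩ hcpos hR (g := (u * a).1)
      ⟨⟨u.1, rfl⟩, ⟨v.1, congrArg Subtype.val hv⟩⟩
    have hwodd : w ∈ oddPolynomials K :=
      mem_oddPolynomials_of_comp (p * a).2 (hw ▸ (u * a).2) hcpos
    exact ⟨⟨w, hwodd⟩, Subtype.ext hw.symm⟩
  · rintro ⟨m, rfl⟩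
    refine ⟨⟨m * p, mul_assoc _ _ _⟩, ⟨m * q, ?_⟩⟩
    simp only [mul_assoc, hpq]

end OddPolynomial

theorem theorem1p2 (K : Type*) [Field K] [CharZero K] :
    IsReductionMonoid (OddPolynomial K) OddPolynomial.deg where
  add_mul a b c := Subtype.ext add_comp
  size_mul := OddPolynomial.deg_mul
  size_add_le a b := natDegree_add_le a.1 b.1
  isUnit_iff := OddPolynomial.isUnit_iff_deg_eq_one
  cancel_right a b c hc h := OddPolynomial.mul_right_cancel_of_deg_pos (zero_lt_one.trans hc) h
  inter_principal := OddPolynomial.exists_inter_eq_range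
  common_right_factor := by
    rintro α a β b i j k hab rfl ha rfl hb hpos hcop
    have hk : 0 < k := Nat.pos_of_mul_pos_left hpos
    have hij : 0 < α.deg * β.deg := Nat.pos_of_mul_pos_right hpos
    obtain ⟨a₁, ha₁, b₁, hb₁, c, hc, hac, hbc, hck⟩ := exists_odd_common_right_factor a.2 b.2
      (congrArg Subtype.val hab) (Nat.pos_of_mul_pos_right hij) (Nat.pos_of_mul_pos_left hij) hk
      hcop ha hb
    exact ⟨⟨a₁, ha₁⟩, ⟨b₁, hb₁⟩, ⟨c, hc⟩, Subtype.ext hac, Subtype.ext hbc, hck⟩
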